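/- Let $k$ be a field, let $g\in (x,y)k[[x,y]]$, and let $R=k[[x,y,z]]/(z^2+g(x,y))$ (for instance, a 2-dimensional ADE singularity). Let $\mathfrak m$ be the maximal ideal of $R$, let $d=\dim R$, let $E$ be the injective hull of the residue field of $R$, and let $\omega=\operatorname{Hom}_R(H^d_{\mathfrak m}(R),E)$ be the canonical module. For $R$-modules $B$ and $L\subseteq W$, the module closure of $L$ in $W$ coming from $B$ is $$L_W^{\mathrm{cl}_B}=\{w\in W : b\otimes w\in \operatorname{im}(B\otimes_R L\to B\otimes_R W)\text{ for all } b\in B\}.$$ The ring $R$ is called $\mathrm{cl}_B$-rational if $\tau_{\mathrm{cl}_B}(\omega)=\omega$, where $$\tau_{\mathrm{cl}_B}(\omega)=\operatorname{Ann}_\omega\bigl(0^{\mathrm{cl}_B}_{H^d_{\mathfrak m}(R)}\bigr)=\{f\in\omega : f(\eta)=0 \text{ for all } \eta\in 0^{\mathrm{cl}_B}_{H^d_{\mathfrak m}(R)}\}.$$ Let $M$ be an $R$-module (for instance, a maximal Cohen--Macaulay module) that is isomorphic to the cokernel of a matrix $zI_n-\varphi : R^n\to R^n$, where $\varphi$ is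 an $n\times n$ matrix with entries in $(x,y)k[[x,y]]$. Then $z\in (x,y)_R^{\mathrm{cl}_M}$, $z\notin (x,y)R$, and $R$ is not $\mathrm{cl}_M$-rational. -/

import Mathlib

open scoped TensorProduct

universe u v

/-! ### Closure operations and module closures -/

/-- A closure operation on the category of `R`-modules: to every submodule `L ⊆ W` it assigns a
submodule `L^cl_W` of `W`, extensively, idempotently and monotonically. -/
structure ClosureOperation (R : Type u) [CommRing R] where
  /-- The closure `L^cl_W` of the submodule `L` in the module `W`. -/
  cl : ∀ {W : Type u} [AddCommGroup W] [Module R W], Submodule R W → Submodule R W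
  le_cl : ∀ {W : Type u} [AddCommGroup W] [Module R W] (L : Submodule R W), L ≤ cl L
  cl_cl : ∀ {W : Type u} [AddCommGroup W] [Module R W] (L : Submodule R W), cl (cl L) = cl L
  cl_mono : ∀ {W : Type u} [AddCommGroup W] [Module R W] {L L' : Submodule R W},
    L ≤ L' → cl L ≤ cl L'

section ModuleClosure

variable {R : Type u} [CommRing R] (B : Type v) [AddCommGroup B] [Module R B]

/-- The submodule `{x ∈ W | b ⊗ x ∈ im (B ⊗ L → B ⊗ W) for all b ∈ B}` of `W`. -/
def moduleClosureSubmodule {W : Type u} [AddCommGroup W] [Module R W] (L : Submodule R W) :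
    Submodule R W where
  carrier := {x | ∀ b : B, b ⊗ₜ[R] x ∈ LinearMap.range (LinearMap.lTensor B L.subtype)}
  zero_mem' := fun b => by
    rw [TensorProduct.tmul_zero]
    exact Submodule.zero_mem _
  add_mem' := fun hx hy b => by
    rw [TensorProduct.tmul_add]
    exact Submodule.add_mem _ (hx b) (hy b)
  smul_mem' := fun r x hx b => by
    rw [TensorProduct.tmul_smul]
    exact Submodule.smul_mem _ r (hx b)

theorem range_lTensor_le_of_le_moduleClosureSubmodule {W : Type u} [AddCommGroup W] [Module R W]
    {L L' : Submodule R W} (h : L' ≤ moduleClosureSubmodule B L) :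
    LinearMap.range (LinearMap.lTensor B L'.subtype) ≤
      LinearMap.range (LinearMap.lTensor B L.subtype) := by
  rintro _ ⟨t, rfl⟩
  induction t using TensorProduct.induction_on with
  | zero => rw [map_zero]; exact Submodule.zero_mem _
  | tmul b l => exact h l.2 b
  | add s t hs ht => rw [map_add]; exact Submodule.add_mem _ hs ht

theorem le_moduleClosureSubmodule {W : Type u} [AddCommGroup W] [Module R W]
    (L : Submodule R W) : L ≤ moduleClosureSubmodule B L :=
  fun x hx b => ⟨b ⊗ₜ[R] ⟨x, hx⟩, rfl⟩

/-- The module closure `cl_B` coming from the `R`-module `B`. -/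
def moduleClosure : ClosureOperation R where
  cl := fun L => moduleClosureSubmodule B L
  le_cl := fun L => le_moduleClosureSubmodule B L
  cl_cl := fun _ => le_antisymm
    (fun _ hx b => range_lTensor_le_of_le_moduleClosureSubmodule B le_rfl (hx b))
    (le_moduleClosureSubmodule B _)
  cl_mono := fun {_ _ _ _ _} h _ hx b => range_lTensor_le_of_le_moduleClosureSubmodule B
    (h.trans (le_moduleClosureSubmodule B _)) (hx b)

end ModuleClosure

/-! ### Injective hulls -/

/-- `ι : N → E` is an injective hull of `N`: it is an essential embedding of `N` into an injective
module. -/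
structure IsInjectiveHull {R : Type u} [CommRing R] {N E : Type u} [AddCommGroup N] [Module R N]
    [AddCommGroup E] [Module R E] (ι : N →ₗ[R] E) : Prop where
  module_injective : Module.Injective R E
  injective : Function.Injective ι
  essential : ∀ S : Submodule R E, S ≠ ⊥ → S ⊓ LinearMap.range ι ≠ ⊥

theorem exists_isInjectiveHull (R : Type u) [CommRing R] (N : Type u) [AddCommGroup N]
    [Module R N] : ∃ (E : ModuleCat.{u} R) (ι : N →ₗ[R] E), IsInjectiveHull ι := by
  obtain ⟨I, hI, j, hj⟩ : ∃ (I : ModuleCat.{u} R) (_ : Module.Injective R I) (j : N →ₗ[R] I),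
      Function.Injective j := by
    obtain ⟨⟨J, hJ, f, hf⟩⟩ := CategoryTheory.EnoughInjectives.presentation (ModuleCat.of R N)
    exact ⟨J, (Module.injective_iff_injective_object R J).2 hJ, f.hom,
      (ModuleCat.mono_iff_injective f).1 hf⟩
  set A : Submodule R I := LinearMap.range j with hA
  -- a maximal essential extension of `A` inside `I`
  let P : Set (Submodule R I) :=
    {S | A ≤ S ∧ ∀ x ∈ S, x ≠ 0 → ∃ r : R, r • x ∈ A ∧ r • x ≠ 0}
  have hAP : A ∈ P := ⟨le_rfl, fun x hx hx0 => ⟨1, by simpa using hx, by simpa using hx0⟩⟩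
  obtain ⟨E, hAE, hE⟩ := zorn_le_nonempty₀ P (fun c hc hch y hy =>
    ⟨sSup c, ⟨(hc hy).1.trans (le_sSup hy), fun x hx hx0 => by
      obtain ⟨S, hS, hxS⟩ := (Submodule.mem_sSup_of_directed ⟨y, hy⟩ hch.directedOn).1 hx
      exact (hc hS).2 x hxS hx0⟩, fun z hz => le_sSup hz⟩) A hAP
  -- a submodule of `I` maximal among those meeting `E` trivially
  let Q : Set (Submodule R I) := {C | ∀ x ∈ E, x ∈ C → x = 0}
  obtain ⟨C, -, hC⟩ := zorn_le_nonempty₀ Q (fun c hc hch y hy =>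
    ⟨sSup c, fun x hx hxc => by
      obtain ⟨S, hS, hxS⟩ := (Submodule.mem_sSup_of_directed ⟨y, hy⟩ hch.directedOn).1 hxc
      exact hc hS x hx hxS, fun z hz => le_sSup hz⟩) ⊥ (fun x _ hx => by simpa using hx)
  have hpinj : Function.Injective (C.mkQ ∘ₗ E.subtype) := by
    rw [injective_iff_map_eq_zero]
    intro x hx
    have hx' : (x : I) ∈ C := by simpa using hx
    exact Subtype.ext (hC.prop x x.2 hx')
  obtain ⟨g, hg⟩ := hI.out (C.mkQ ∘ₗ E.subtype) hpinj E.subtype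
  have hgE : ∀ x ∈ E, g (C.mkQ x) = x := fun x hx => hg ⟨x, hx⟩
  have hrange : LinearMap.range (g ∘ₗ C.mkQ) ∈ P := by
    refine ⟨fun a ha => ⟨a, hgE a (hE.prop.1 ha)⟩, ?_⟩
    rintro _ ⟨w, rfl⟩ hw0
    obtain ⟨e, heE, heC, he0⟩ : ∃ e ∈ E, e ∈ C ⊔ Submodule.span R {w} ∧ e ≠ 0 := by
      by_contra! hcon
      have hle := hC.le_of_ge (y := C ⊔ Submodule.span R {w}) hcon le_sup_left
      have hwC : w ∈ C := hle (Submodule.mem_sup_right (Submodule.mem_span_singleton_self w))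
      apply hw0
      simp [(Submodule.Quotient.mk_eq_zero C).2 hwC]
    obtain ⟨c, hc, w', hw', rfl⟩ := Submodule.mem_sup.1 heC
    obtain ⟨r, rfl⟩ := Submodule.mem_span_singleton.1 hw'
    have hkey : r • (g ∘ₗ C.mkQ) w = c + r • w := by
      have h1 := hgE _ heE
      rw [map_add, show C.mkQ c = 0 from (Submodule.Quotient.mk_eq_zero C).2 hc, zero_add, map_smul,
        map_smul] at h1
      exact h1
    obtain ⟨s, hs, hs0⟩ := hE.prop.2 _ heE he0
    exact ⟨s * r, by rwa [mul_smul, hkey], by rwa [mul_smul, hkey]⟩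
  have hle : LinearMap.range (g ∘ₗ C.mkQ) ≤ E :=
    hE.le_of_ge hrange (fun e he => ⟨e, hgE e he⟩)
  have hjE : ∀ n, j n ∈ E := fun n => hE.prop.1 ⟨n, rfl⟩
  refine ⟨ModuleCat.of R E, j.codRestrict E hjE, ?_, ?_, ?_⟩
  · refine ⟨fun X Y _ _ _ _ f hf h => ?_⟩
    obtain ⟨h', hh'⟩ := hI.out f hf (E.subtype ∘ₗ h)
    refine ⟨((g ∘ₗ C.mkQ) ∘ₗ h').codRestrict E (fun y => hle ⟨h' y, rfl⟩), fun x => ?_⟩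
    apply Subtype.ext
    change g (C.mkQ (h' (f x))) = (h x : I)
    rw [hh' x]
    exact hgE _ (h x).2
  · intro a b hab
    exact hj (congrArg Subtype.val hab)
  · intro S hS hbot
    obtain ⟨x, hxS, hx0⟩ := S.exists_mem_ne_zero_of_ne_bot hS
    obtain ⟨r, ⟨n, hn⟩, hr0⟩ := hE.prop.2 (x : I) x.2 (fun h => hx0 (Subtype.ext h))
    have hmem : r • x ∈ S ⊓ LinearMap.range (j.codRestrict E hjE) :=
      ⟨S.smul_mem r hxS, n, Subtype.ext hn⟩
    rw [hbot] at hmem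
    exact hr0 (congrArg Subtype.val ((Submodule.mem_bot R).1 hmem))

/-! ### Rationality with respect to a closure operation -/

section Rationality

variable (R : Type u) [CommRing R] [IsLocalRing R]

/-- The injective hull `E_R(k)` of the residue field `k` of `R`. -/
noncomputable def residueHull : ModuleCat.{u} R :=
  (exists_isInjectiveHull R (IsLocalRing.ResidueField R)).choose

/-- The top local cohomology module `H^d_m(R)`, where `m` is the maximal ideal and `d` is the
Krull dimension of `R` (a natural number when `R` is Noetherian). -/
noncomputable def topLocalCohomology : ModuleCat.{u} R :=
  (localCohomology (IsLocalRing.maximalIdeal R) ((ringKrullDim R).unbotD 0).toNat).obj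
    (ModuleCat.of R R)

/-- The canonical module `ω` of a complete Noetherian local ring `R`: the Matlis dual
`Hom_R(H^d_m(R), E_R(k))` of its top local cohomology module. -/
abbrev canonicalModule : Type u := topLocalCohomology R →ₗ[R] residueHull R

variable {R}

/-- The test submodule `τ_cl(ω) = Ann_ω (0^cl_{H^d_m(R)})` of the canonical module `ω`, i.e. the
set of all `f ∈ ω = Hom_R(H^d_m(R), E_R(k))` that vanish on `0^cl_{H^d_m(R)}`. -/
noncomputable def testSubmodule (c : ClosureOperation R) : Submodule R (canonicalModule R) where
  carrier := {f | ∀ η ∈ c.cl (⊥ : Submodule R (topLocalCohomology R)), f η = 0}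
  zero_mem' := fun _ _ => rfl
  add_mem' := fun hf hg η hη => by rw [LinearMap.add_apply, hf η hη, hg η hη, add_zero]
  smul_mem' := fun r f hf η hη => by rw [LinearMap.smul_apply, hf η hη, smul_zero]

/-- A complete Cohen-Macaulay local ring `R` is `cl`-rational if `τ_cl(ω) = ω`. -/
def IsClRational (c : ClosureOperation R) : Prop :=
  testSubmodule c = ⊤

end Rationality

/-! ### The rings `k[[x,y,z]]/(z² + g(x,y))` -/

section DoublePoint

variable {k : Type u} [Field k]

/-- The inclusion `k[[x,y]] → k[[x,y,z]]`; the variables `x, y, z` have indices `0, 1, 2`. -/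
noncomputable def inclXY : MvPowerSeries (Fin 2) k →+* MvPowerSeries (Fin 3) k :=
  (MvPowerSeries.rename (R := k) (Fin.castSucc : Fin 2 → Fin 3)).toRingHom

/-- The ring `k[[x,y,z]]/(z² + g(x,y))`. -/
abbrev DoublePointRing (g : MvPowerSeries (Fin 2) k) : Type u :=
  MvPowerSeries (Fin 3) k ⧸
    Ideal.span {(MvPowerSeries.X 2 ^ 2 + inclXY g : MvPowerSeries (Fin 3) k)}

namespace DoublePointRing

variable (g : MvPowerSeries (Fin 2) k)

/-- The class of `x`. -/
noncomputable def x : DoublePointRing g := Ideal.Quotient.mk _ (MvPowerSeries.X 0)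

/-- The class of `y`. -/
noncomputable def y : DoublePointRing g := Ideal.Quotient.mk _ (MvPowerSeries.X 1)

/-- The class of `z`. -/
noncomputable def z : DoublePointRing g := Ideal.Quotient.mk _ (MvPowerSeries.X 2)

/-- The natural ring homomorphism `k[[x,y]] → k[[x,y,z]]/(z² + g)`. -/
noncomputable def ofXY : MvPowerSeries (Fin 2) k →+* DoublePointRing g :=
  (Ideal.Quotient.mk _).comp inclXY

variable {g}

theorem isLocalRing
    (hg : g ∈ Ideal.span {(MvPowerSeries.X 0 : MvPowerSeries (Fin 2) k), MvPowerSeries.X 1}) :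
    IsLocalRing (DoublePointRing g) := by
  have h0 : MvPowerSeries.constantCoeff (MvPowerSeries.X 2 ^ 2 + inclXY g :
      MvPowerSeries (Fin 3) k) = 0 := by
    obtain ⟨a, b, rfl⟩ := Ideal.mem_span_pair.1 hg
    have hX : ∀ i : Fin 2, inclXY (MvPowerSeries.X i : MvPowerSeries (Fin 2) k) =
        MvPowerSeries.X i.castSucc := fun i => MvPowerSeries.rename_X _ i
    simp [hX]
  have : Nontrivial (DoublePointRing g) := by
    refine Ideal.Quotient.nontrivial_iff.2 fun htop => ?_
    obtain ⟨a, ha⟩ := Ideal.mem_span_singleton'.1 ((Ideal.eq_top_iff_one _).1 htop)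
    have := congrArg MvPowerSeries.constantCoeff ha
    rw [map_mul, h0, mul_zero, map_one] at this
    exact zero_ne_one this
  exact IsLocalRing.of_surjective' (Ideal.Quotient.mk _) Ideal.Quotient.mk_surjective

end DoublePointRing

end DoublePoint

/-! In the cokernel `M` of `zI - φ`, multiplication by `z` agrees with `φ`, so `zM ⊆ (x,y)M`; this
puts `z` in the `M`-closure of `(x,y)`. Since `g ∈ (x,y)`, the quotient `R/(x,y)` is `k[[z]]/(z²)`,
so `z ∉ (x,y)`.

For non-rationality it suffices to find `η` in `H²_m(R)` with `xη = yη = 0` and `zη ≠ 0`. Indeed `m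
⊗ zη = zm ⊗ η = (xm₁ + ym₂) ⊗ η = 0`, so `zη` lies in the closure of zero, while some map to `E`
does not kill it (`exists_residueHull_apply_ne_zero`).

In Čech terms `η` is the class of `1/(xy)`. Here local cohomology is the colimit of `Ext²(R/m^t,
R)`, and `m² ⊆ (x,y)`, so `η` comes from the Koszul class pulled back along `R/m² → R/(x,y)`. If
`zη` vanished, it would vanish in some `Ext²(R/m^s, R)`; as `Ext¹(R/m^s, R) = 0`, the null-homotopy
descends to degree zero and forces `z ∈ (x,y)` (`IsRegularPair.mul_mem_span_of_eq_comp`,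
`IsRegularPair.exists_localCohomology`). -/

namespace MvPowerSeries

/-! ### Setting variables of a power series to zero. -/

section CommRing

variable {k : Type u} [CommRing k]

/-- The exponents not involving the first variable are exactly those coming from the remaining `n`
variables. This identifies the quotient by `X 0` with a power series ring in one variable fewer. -/
theorem X_zero_dvd_iff_killCompl_eq_zero {n : ℕ} {f : MvPowerSeries (Fin (n + 1)) k} :
    (X 0 : MvPowerSeries (Fin (n + 1)) k) ∣ f ↔ killCompl (Fin.succEmb n) f = 0 := by
  constructor
  · rintro ⟨a, rfl⟩
    rw [map_mul, killCompl_X_eq_zero, zero_mul]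
    rintro ⟨i, hi⟩
    exact Fin.succ_ne_zero i hi
  · intro h
    rw [X_dvd_iff]
    intro m hm
    obtain ⟨m', rfl⟩ : ∃ m', m = Finsupp.embDomain (Fin.succEmb n) m' := by
      have : m ∈ Set.range (Finsupp.embDomain (Fin.succEmb n)) := by
        rw [Finsupp.mem_range_embDomain_iff]
        intro i hi
        have hi0 : i ≠ 0 := by
          rintro rfl
          simp [hm] at hi
        obtain ⟨j, rfl⟩ := Fin.exists_succ_eq.2 hi0
        exact ⟨j, rfl⟩
      obtain ⟨m', h⟩ := this
      exact ⟨m', h.symm⟩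
    rw [← coeff_killCompl, h, map_zero]

theorem X_zero_dvd_sub_rename_killCompl {n : ℕ} (f : MvPowerSeries (Fin (n + 1)) k) :
    (X 0 : MvPowerSeries (Fin (n + 1)) k) ∣
      f - rename (Fin.succEmb n) (killCompl (Fin.succEmb n) f) := by
  rw [X_zero_dvd_iff_killCompl_eq_zero, map_sub, killCompl_rename_app, sub_self]

theorem killCompl_succEmb_X_zero {n : ℕ} :
    killCompl (R := k) (Fin.succEmb n) (X 0) = 0 :=
  X_zero_dvd_iff_killCompl_eq_zero.1 dvd_rfl

theorem killCompl_succEmb_X_succ {n : ℕ} (i : Fin n) :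
    killCompl (R := k) (Fin.succEmb n) (X i.succ) = X i :=
  killCompl_X (e := Fin.succEmb n) i

end CommRing

variable {k : Type u} [Field k]

theorem prime_X_zero (n : ℕ) : Prime (X 0 : MvPowerSeries (Fin (n + 1)) k) := by
  refine ⟨fun h => ?_, fun h => ?_, fun a b h => ?_⟩
  · have := congrArg (coeff (Finsupp.single 0 1)) h
    rw [coeff_index_single_self_X, map_zero] at this
    exact one_ne_zero this
  · rw [isUnit_iff_constantCoeff, constantCoeff_X] at h
    exact not_isUnit_zero h
  · simp only [X_zero_dvd_iff_killCompl_eq_zero, map_mul] at h ⊢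
    exact mul_eq_zero.1 h

/-- The homomorphism `k[[x,y,z]] → k[[z]]` that sends `x` and `y` to zero. -/
noncomputable def killXY : MvPowerSeries (Fin 3) k →+* MvPowerSeries (Fin 1) k :=
  (killCompl (R := k) (Fin.succEmb 1)).toRingHom.comp (killCompl (R := k) (Fin.succEmb 2)).toRingHom

theorem killXY_apply (f : MvPowerSeries (Fin 3) k) :
    killXY f = killCompl (Fin.succEmb 1) (killCompl (Fin.succEmb 2) f) := rfl

theorem killXY_X_zero : killXY (X 0 : MvPowerSeries (Fin 3) k) = 0 := by
  rw [killXY_apply, killCompl_succEmb_X_zero, map_zero]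

theorem killXY_X_one : killXY (X 1 : MvPowerSeries (Fin 3) k) = 0 := by
  rw [killXY_apply, show (1 : Fin 3) = Fin.succ 0 from rfl, killCompl_succEmb_X_succ,
    killCompl_succEmb_X_zero]

theorem killXY_X_two : killXY (X 2 : MvPowerSeries (Fin 3) k) = X 0 := by
  rw [killXY_apply, show (2 : Fin 3) = Fin.succ (Fin.succ 0) from rfl, killCompl_succEmb_X_succ,
    killCompl_succEmb_X_succ]

theorem mem_span_X_zero_X_one_iff_killXY_eq_zero {f : MvPowerSeries (Fin 3) k} :
    f ∈ Ideal.span {(X 0 : MvPowerSeries (Fin 3) k), X 1} ↔ killXY f = 0 := by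
  constructor
  · intro h
    obtain ⟨a, b, rfl⟩ := Ideal.mem_span_pair.1 h
    rw [map_add, map_mul, map_mul, killXY_X_zero, killXY_X_one, mul_zero, mul_zero, add_zero]
  · intro h
    rw [killXY_apply, ← X_zero_dvd_iff_killCompl_eq_zero] at h
    obtain ⟨b, hb⟩ := h
    -- Subtracting the lift of `f` modulo `X 0` leaves a multiple of `X 0`; the lift itself is a
    -- multiple of `X 1`.
    obtain ⟨a, ha⟩ := X_zero_dvd_sub_rename_killCompl f
    rw [hb, map_mul, rename_X] at ha
    refine Ideal.mem_span_pair.2 ⟨a, rename (Fin.succEmb 2) b, ?_⟩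
    rw [mul_comm a, ← ha, show (1 : Fin 3) = (Fin.succEmb 2) 0 from rfl]
    ring

theorem X_zero_dvd_of_constantCoeff_eq_zero {f : MvPowerSeries (Fin 1) k}
    (hf : constantCoeff f = 0) : (X 0 : MvPowerSeries (Fin 1) k) ∣ f := by
  rw [X_dvd_iff]
  intro m hm
  obtain rfl : m = 0 := by
    ext
    exact hm
  exact hf

theorem constantCoeff_killXY (f : MvPowerSeries (Fin 3) k) :
    constantCoeff (killXY f) = constantCoeff f := by
  rw [killXY_apply, ← coeff_zero_eq_constantCoeff_apply, coeff_killCompl, coeff_killCompl]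
  simp

theorem mem_span_X_of_constantCoeff_eq_zero {f : MvPowerSeries (Fin 3) k}
    (hf : constantCoeff f = 0) :
    ∃ c, f - X 2 * c ∈ Ideal.span {(X 0 : MvPowerSeries (Fin 3) k), X 1} := by
  rw [← constantCoeff_killXY] at hf
  obtain ⟨c, hc⟩ := X_zero_dvd_of_constantCoeff_eq_zero hf
  refine ⟨rename (Fin.succEmb 2) (rename (Fin.succEmb 1) c), ?_⟩
  rw [mem_span_X_zero_X_one_iff_killXY_eq_zero, map_sub, map_mul, killXY_X_two, hc,
    killXY_apply (rename _ _), killCompl_rename_app, killCompl_rename_app, sub_self]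

end MvPowerSeries

/-! ### Regular sequences of length two. -/

/-- `a, b` is a weakly regular sequence on `R`, spelled out in terms of elements. -/
structure IsRegularPair {R : Type u} [CommRing R] (a b : R) : Prop where
  eq_zero_of_mul_eq_zero : ∀ r : R, a * r = 0 → r = 0
  dvd_of_dvd_mul : ∀ r : R, a ∣ b * r → a ∣ r

namespace IsRegularPair

variable {R : Type u} [CommRing R] {a b : R}

theorem mul_left_cancel (h : IsRegularPair a b) {r s : R} (hrs : a * r = a * s) : r = s :=
  sub_eq_zero.1 (h.eq_zero_of_mul_eq_zero _ (by rw [mul_sub, hrs, sub_self]))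

/-- Needed because `R/I^s` is killed by `a^s, b^s` rather than by `a, b`. Factors of `a` are
cancelled one at a time. -/
theorem pow (h : IsRegularPair a b) (m n : ℕ) : IsRegularPair (a ^ m) (b ^ n) := by
  have h1 : ∀ n, ∀ r : R, a ∣ b ^ n * r → a ∣ r := by
    intro n
    induction n with
    | zero => intro r hr; simpa using hr
    | succ n ih => intro r hr; exact h.dvd_of_dvd_mul _ (ih _ (by rwa [pow_succ, mul_assoc] at hr))
  refine ⟨?_, ?_⟩
  · induction m with
    | zero => intro r hr; simpa using hr
    | succ m ih =>
      intro r hr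
      exact h.eq_zero_of_mul_eq_zero _ (ih _ (by rwa [pow_succ, mul_assoc] at hr))
  · induction m with
    | zero => intro r _; rw [pow_zero]; exact one_dvd r
    | succ m ih =>
      rintro r hr
      obtain ⟨r', rfl⟩ := h1 n r ((dvd_pow_self a m.succ_ne_zero).trans hr)
      obtain ⟨t, ht⟩ := hr
      obtain ⟨s, rfl⟩ := ih r' ⟨t, h.mul_left_cancel (by rw [mul_left_comm, ht, pow_succ']; ring)⟩
      exact ⟨s, by ring⟩

open scoped Pointwise in
theorem isWeaklyRegular (h : IsRegularPair a b) :
    RingTheory.Sequence.IsWeaklyRegular R [a, b] := by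
  rw [RingTheory.Sequence.isWeaklyRegular_cons_iff,
    RingTheory.Sequence.isWeaklyRegular_singleton_iff]
  refine ⟨fun r s hrs => h.mul_left_cancel hrs, ?_⟩
  have hmem : ∀ r : R, r ∈ (a • (⊤ : Submodule R R) : Submodule R R) ↔ a ∣ r := fun r => by
    constructor
    · rintro ⟨s, -, rfl⟩
      exact ⟨s, rfl⟩
    · rintro ⟨s, rfl⟩
      exact ⟨s, trivial, rfl⟩
  intro r s hrs
  obtain ⟨r, rfl⟩ := Submodule.Quotient.mk_surjective _ r
  obtain ⟨s, rfl⟩ := Submodule.Quotient.mk_surjective _ s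
  change b • Submodule.Quotient.mk r = b • Submodule.Quotient.mk s at hrs
  rw [← Submodule.Quotient.mk_smul, ← Submodule.Quotient.mk_smul, Submodule.Quotient.eq, hmem,
    ← smul_sub] at hrs
  rw [Submodule.Quotient.eq, hmem]
  exact h.dvd_of_dvd_mul _ hrs

end IsRegularPair

/-! ### The double point: `x, y` is regular, `m² ⊆ (x,y)`, and the dimension is two. -/

namespace DoublePointRing

open MvPowerSeries

variable {k : Type u} [Field k] {g : MvPowerSeries (Fin 2) k}

theorem inclXY_X (i : Fin 2) : inclXY (X i : MvPowerSeries (Fin 2) k) = X i.castSucc :=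
  rename_X _ i

theorem killXY_equation
    (hg : g ∈ Ideal.span {(MvPowerSeries.X 0 : MvPowerSeries (Fin 2) k), MvPowerSeries.X 1}) :
    killXY (X 2 ^ 2 + inclXY g) = X 0 ^ 2 := by
  obtain ⟨a, b, rfl⟩ := Ideal.mem_span_pair.1 hg
  simp only [map_add, map_mul, map_pow, inclXY_X, killXY_X_two]
  rw [show (Fin.castSucc 0 : Fin 3) = 0 from rfl, show (Fin.castSucc 1 : Fin 3) = 1 from rfl,
    killXY_X_zero, killXY_X_one]
  simp

theorem mk_eq_zero_iff {f : MvPowerSeries (Fin 3) k} :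
    (Ideal.Quotient.mk _ f : DoublePointRing g) = 0 ↔ (X 2 ^ 2 + inclXY g) ∣ f := by
  rw [Ideal.Quotient.eq_zero_iff_mem, Ideal.mem_span_singleton]

theorem ofXY_mem {f : MvPowerSeries (Fin 2) k}
    (hf : f ∈ Ideal.span {(MvPowerSeries.X 0 : MvPowerSeries (Fin 2) k), MvPowerSeries.X 1}) :
    ofXY g f ∈ Ideal.span {x g, y g} := by
  obtain ⟨a, b, rfl⟩ := Ideal.mem_span_pair.1 hf
  refine Ideal.mem_span_pair.2 ⟨ofXY g a, ofXY g b, ?_⟩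
  rw [map_add, map_mul, map_mul]
  simp only [ofXY, RingHom.comp_apply, inclXY_X]
  rfl

theorem z_sq_mem
    (hg : g ∈ Ideal.span {(X 0 : MvPowerSeries (Fin 2) k), X 1}) :
    z g ^ 2 ∈ Ideal.span {x g, y g} := by
  have h : z g ^ 2 = - ofXY g g := by
    rw [eq_neg_iff_add_eq_zero]
    exact mk_eq_zero_iff.2 dvd_rfl
  rw [h]
  exact neg_mem (ofXY_mem hg)

/-- Setting `x = y = 0` in such a relation would make `z` a multiple of `z²` in `k[[z]]`. -/
theorem z_not_mem
    (hg : g ∈ Ideal.span {(X 0 : MvPowerSeries (Fin 2) k), X 1}) :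
    z g ∉ Ideal.span {x g, y g} := by
  intro h
  obtain ⟨a, b, h⟩ := Ideal.mem_span_pair.1 h
  obtain ⟨a, rfl⟩ := Ideal.Quotient.mk_surjective a
  obtain ⟨b, rfl⟩ := Ideal.Quotient.mk_surjective b
  rw [x, y, z, ← map_mul, ← map_mul, ← map_add, ← sub_eq_zero, ← map_sub, mk_eq_zero_iff] at h
  obtain ⟨c, hc⟩ := h
  have h := congrArg killXY hc
  rw [map_mul, killXY_equation hg, map_sub, map_add, map_mul, map_mul, killXY_X_zero, killXY_X_one,
    killXY_X_two, mul_zero, mul_zero, zero_add, zero_sub] at h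
  have hp := prime_X_zero (k := k) 0
  refine hp.not_dvd_one ⟨-killXY c, mul_left_cancel₀ hp.ne_zero ?_⟩
  linear_combination -h

/-- With `F = z² + g`, the element `x` is prime and does not divide `F`, and modulo `x` the prime
`y` does not divide `F`. Divisibility by `F` is thus traded for divisibility by these primes. -/
theorem isRegularPair
    (hg : g ∈ Ideal.span {(X 0 : MvPowerSeries (Fin 2) k), X 1}) : IsRegularPair (x g) (y g) := by
  have hp := prime_X_zero (k := k) 2
  have hF : ¬ (X 0 : MvPowerSeries (Fin 2) k) ∣ killCompl (Fin.succEmb 2) (X 2 ^ 2 + inclXY g) := by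
    rw [X_zero_dvd_iff_killCompl_eq_zero, ← killXY_apply, killXY_equation hg]
    exact pow_ne_zero _ (prime_X_zero 0).ne_zero
  have hF' : ¬ (X 0 : MvPowerSeries (Fin 3) k) ∣ (X 2 ^ 2 + inclXY g) := by
    rw [X_zero_dvd_iff_killCompl_eq_zero]
    intro h
    exact hF (h ▸ dvd_zero _)
  refine ⟨fun r hr => ?_, ?_⟩
  · obtain ⟨r, rfl⟩ := Ideal.Quotient.mk_surjective r
    rw [x, ← map_mul, mk_eq_zero_iff] at hr
    obtain ⟨c, hc⟩ := hr
    obtain ⟨d, rfl⟩ := (hp.dvd_or_dvd (Dvd.intro _ hc)).resolve_left hF'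
    rw [mul_left_comm] at hc
    exact mk_eq_zero_iff.2 ⟨d, mul_left_cancel₀ hp.ne_zero hc⟩
  · rintro r ⟨s, hs⟩
    obtain ⟨r, rfl⟩ := Ideal.Quotient.mk_surjective r
    obtain ⟨s, rfl⟩ := Ideal.Quotient.mk_surjective s
    rw [x, y, ← map_mul, ← map_mul, ← sub_eq_zero, ← map_sub, mk_eq_zero_iff] at hs
    obtain ⟨c, hc⟩ := hs
    have h := congrArg (killCompl (Fin.succEmb 2)) hc
    rw [map_sub, map_mul, map_mul, map_mul, killCompl_succEmb_X_zero, zero_mul, sub_zero,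
      show (1 : Fin 3) = Fin.succ 0 from rfl, killCompl_succEmb_X_succ] at h
    obtain ⟨d, hd⟩ := ((prime_X_zero (k := k) 1).dvd_or_dvd (Dvd.intro _ h)).resolve_left hF
    rw [hd, mul_left_comm] at h
    have h := mul_left_cancel₀ (prime_X_zero 1).ne_zero h
    -- By `h`, the series `r` equals `F·d` modulo `x`; after lifting `d` to three variables the
    -- difference is a multiple of `x`.
    obtain ⟨e, he⟩ : (X 0 : MvPowerSeries (Fin 3) k) ∣
        r - (X 2 ^ 2 + inclXY g) * rename (Fin.succEmb 2) d := by
      rw [X_zero_dvd_iff_killCompl_eq_zero, map_sub, map_mul, killCompl_rename_app, h, sub_self]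
    refine ⟨Ideal.Quotient.mk _ e, ?_⟩
    rw [x, ← map_mul, ← he, map_sub, map_mul, (mk_eq_zero_iff (g := g)).2 dvd_rfl, zero_mul,
      sub_zero]

/-- Modulo `(x,y)` every element of `m` is a multiple of `z`, and `z² = -g` lies in `(x,y)`. -/
theorem maximalIdeal_sq_le
    (hg : g ∈ Ideal.span {(X 0 : MvPowerSeries (Fin 2) k), X 1}) :
    haveI : IsLocalRing (DoublePointRing g) := isLocalRing hg
    IsLocalRing.maximalIdeal (DoublePointRing g) ^ 2 ≤ Ideal.span {x g, y g} := by
  have : IsLocalRing (DoublePointRing g) := isLocalRing hg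
  have key : ∀ r ∈ IsLocalRing.maximalIdeal (DoublePointRing g),
      ∃ c, r - z g * c ∈ Ideal.span {x g, y g} := by
    intro r hr
    obtain ⟨r, rfl⟩ := Ideal.Quotient.mk_surjective r
    have hr0 : constantCoeff r = 0 := by
      by_contra h
      exact hr (((isUnit_iff_constantCoeff).2 (isUnit_iff_ne_zero.2 h)).map _)
    obtain ⟨c, hc⟩ := mem_span_X_of_constantCoeff_eq_zero hr0
    obtain ⟨a, b, h⟩ := Ideal.mem_span_pair.1 hc
    refine ⟨Ideal.Quotient.mk _ c, Ideal.mem_span_pair.2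
      ⟨Ideal.Quotient.mk _ a, Ideal.Quotient.mk _ b, ?_⟩⟩
    simp only [x, y, z]
    rw [← map_mul, ← map_mul, ← map_mul, ← map_add, ← map_sub, h]
  rw [show IsLocalRing.maximalIdeal (DoublePointRing g) ^ 2 =
    IsLocalRing.maximalIdeal (DoublePointRing g) * IsLocalRing.maximalIdeal (DoublePointRing g)
    from pow_two _, Ideal.mul_le]
  intro r hr s hs
  obtain ⟨c, hc⟩ := key r hr
  obtain ⟨d, hd⟩ := key s hs
  have h : r * s = (r - z g * c) * s + (z g * c) * (s - z g * d) + c * d * z g ^ 2 := by ring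
  rw [h]
  exact add_mem (add_mem (Ideal.mul_mem_right _ _ hc) (Ideal.mul_mem_left _ _ hd))
    (Ideal.mul_mem_left _ _ (z_sq_mem hg))

theorem x_mem_maximalIdeal
    (hg : g ∈ Ideal.span {(X 0 : MvPowerSeries (Fin 2) k), X 1}) :
    haveI : IsLocalRing (DoublePointRing g) := isLocalRing hg
    x g ∈ IsLocalRing.maximalIdeal (DoublePointRing g) := by
  have : IsLocalRing (DoublePointRing g) := isLocalRing hg
  intro h
  exact z_not_mem hg (by
    rw [Ideal.eq_top_of_isUnit_mem _ (Ideal.subset_span (Set.mem_insert _ _)) h]; trivial)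

theorem y_mem_maximalIdeal
    (hg : g ∈ Ideal.span {(X 0 : MvPowerSeries (Fin 2) k), X 1}) :
    haveI : IsLocalRing (DoublePointRing g) := isLocalRing hg
    y g ∈ IsLocalRing.maximalIdeal (DoublePointRing g) := by
  have : IsLocalRing (DoublePointRing g) := isLocalRing hg
  intro h
  exact z_not_mem hg (by
    rw [Ideal.eq_top_of_isUnit_mem _
      (Ideal.subset_span (Set.mem_insert_of_mem _ (Set.mem_singleton _))) h]; trivial)

/-- Dividing by the regular sequence `x, y` lowers the dimension by two, and in the quotient every
prime contains the nilpotent image of `m`. -/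
theorem ringKrullDim_eq_two
    (hg : g ∈ Ideal.span {(X 0 : MvPowerSeries (Fin 2) k), X 1}) :
    ringKrullDim (DoublePointRing g) = 2 := by
  have : IsLocalRing (DoublePointRing g) := isLocalRing hg
  have hreg : RingTheory.Sequence.IsRegular (DoublePointRing g) [x g, y g] := by
    rw [IsLocalRing.isRegular_iff_isWeaklyRegular_of_subset_maximalIdeal]
    · exact (isRegularPair hg).isWeaklyRegular
    · intro r hr
      simp only [List.mem_cons, List.not_mem_nil, or_false] at hr
      rcases hr with rfl | rfl
      · exact x_mem_maximalIdeal hg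
      · exact y_mem_maximalIdeal hg
  have hq : Ideal.ofList [x g, y g] = Ideal.span {x g, y g} := by
    simp [Ideal.ofList, Set.insert_def]
  have h := ringKrullDim_add_length_eq_ringKrullDim_of_isRegular _ hreg
  rw [hq] at h
  have : Nontrivial (DoublePointRing g ⧸ Ideal.span {x g, y g}) :=
    Ideal.Quotient.nontrivial_iff.2 fun h => z_not_mem hg (h ▸ trivial)
  have : Ring.KrullDimLE 0 (DoublePointRing g ⧸ Ideal.span {x g, y g}) := by
    refine Ring.KrullDimLE.mk₀ fun P hP => ?_
    have hsurj := Ideal.Quotient.mk_surjective (I := Ideal.span {x g, y g})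
    have hle : IsLocalRing.maximalIdeal (DoublePointRing g) ≤
        P.comap (Ideal.Quotient.mk (Ideal.span {x g, y g})) := by
      refine Ideal.IsPrime.le_of_pow_le (n := 2) ((maximalIdeal_sq_le hg).trans fun r hr => ?_)
      rw [Ideal.mem_comap, Ideal.Quotient.eq_zero_iff_mem.2 hr]
      exact zero_mem P
    have hmax : (P.comap (Ideal.Quotient.mk (Ideal.span {x g, y g}))).IsMaximal := by
      rw [← (IsLocalRing.maximalIdeal.isMaximal _).eq_of_le (Ideal.comap_ne_top _ hP.ne_top) hle]
      infer_instance
    rw [← Ideal.map_comap_of_surjective _ hsurj P]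
    exact hmax.map_of_surjective_of_ker_le hsurj fun r hr => by
      rw [Ideal.mem_comap, (RingHom.mem_ker).1 hr]
      exact zero_mem P
  rw [(ringKrullDimZero_iff_ringKrullDim_eq_zero).1 this] at h
  simpa using h.symm

end DoublePointRing

/-! ### Homological algebra over a regular pair. -/

namespace LinearMap

variable {R : Type*} [CommRing R]

/-- Quotients by a nonzerodivisor are unique, so choosing them pointwise is automatically linear. -/
theorem exists_eq_smul_of_forall_dvd {a : R} (ha : ∀ r : R, a * r = 0 → r = 0)
    {Q : Type*} [AddCommGroup Q] [Module R Q] (h : Q →ₗ[R] R) (hdvd : ∀ q, a ∣ h q) :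
    ∃ t : Q →ₗ[R] R, ∀ q, h q = a * t q := by
  choose t ht using hdvd
  have hcancel : ∀ r s, a * r = a * s → r = s := fun r s hrs =>
    sub_eq_zero.1 (ha _ (by rw [mul_sub, hrs, sub_self]))
  refine ⟨{ toFun := t, map_add' := fun p q => hcancel _ _ ?_,
            map_smul' := fun r q => hcancel _ _ ?_ }, ht⟩
  · rw [mul_add, ← ht, ← ht, ← ht, map_add]
  · rw [RingHom.id_apply, smul_eq_mul, mul_left_comm, ← ht, ← ht, map_smul, smul_eq_mul]

theorem exists_eq_mul_add_mul_of_mem_span_pair {a b : R}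
    {Q : Type*} [AddCommGroup Q] [Module R Q] [Module.Projective R Q] (h : Q →ₗ[R] R)
    (hmem : ∀ q, h q ∈ Ideal.span {a, b}) :
    ∃ v w : Q →ₗ[R] R, ∀ q, h q = a * v q + b * w q := by
  let s : R × R →ₗ[R] R := (LinearMap.mul R R a).coprod (LinearMap.mul R R b)
  have hs : ∀ p, s p = a * p.1 + b * p.2 := fun p => rfl
  have hh : ∀ q, h q ∈ range s := fun q => by
    obtain ⟨r, t, hrt⟩ := Ideal.mem_span_pair.1 (hmem q)
    exact ⟨(r, t), by rw [hs, ← hrt]; ring⟩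
  obtain ⟨l, hl⟩ := Module.projective_lifting_property s.rangeRestrict (h.codRestrict _ hh)
    s.surjective_rangeRestrict
  refine ⟨(fst R R R).comp l, (snd R R R).comp l, fun q => ?_⟩
  have := congrArg Subtype.val (LinearMap.congr_fun hl q)
  exact this.symm

end LinearMap

namespace IsRegularPair

variable {R : Type*} [CommRing R] {a b : R}

section

variable {Q₀ Q₁ Q₂ : Type*} [AddCommGroup Q₀] [AddCommGroup Q₁] [AddCommGroup Q₂]
  [Module R Q₀] [Module R Q₁] [Module R Q₂]

/-- The vanishing of `Ext¹(N, R)` for a module `N` killed by a regular sequence of length two. -/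
theorem exists_eq_comp_of_comp_eq_zero (hab : IsRegularPair a b) [Module.Projective R Q₀]
    (d₁ : Q₁ →ₗ[R] Q₀) (d₂ : Q₂ →ₗ[R] Q₁) (hd : Function.Exact d₂ d₁)
    (ha : ∀ q, a • q ∈ LinearMap.range d₁) (hb : ∀ q, b • q ∈ LinearMap.range d₁)
    (f : Q₁ →ₗ[R] R) (hf : ∀ q, f (d₂ q) = 0) :
    ∃ t : Q₀ →ₗ[R] R, ∀ q, f q = t (d₁ q) := by
  have hker : ∀ p q, d₁ p = d₁ q → f p = f q := fun p q hpq => by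
    obtain ⟨r, hr⟩ := (hd (p - q)).1 (by rw [map_sub, hpq, sub_self])
    rw [← sub_eq_zero, ← map_sub, ← hr, hf]
  -- Since `a` kills the cokernel, `a` on `Q₀` factors as `d₁ ∘ s`. Then `f ∘ s` should be `a` times
  -- the desired `t`.
  obtain ⟨s, hs⟩ := Module.projective_lifting_property d₁.rangeRestrict
    ((LinearMap.lsmul R Q₀ a).codRestrict _ ha) d₁.surjective_rangeRestrict
  have hs : ∀ q, d₁ (s q) = a • q := fun q => congrArg Subtype.val (LinearMap.congr_fun hs q)
  obtain ⟨t, ht⟩ := LinearMap.exists_eq_smul_of_forall_dvd hab.eq_zero_of_mul_eq_zero (f.comp s)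
    (fun q => by
      -- If `d₁ p = b q`, then `b • s q` and `a • p` have the same image under `d₁`, so `b f(s q) =
      -- a f(p)`.
      refine hab.dvd_of_dvd_mul _ ?_
      obtain ⟨p, hp⟩ := hb q
      refine ⟨f p, ?_⟩
      rw [LinearMap.comp_apply, ← smul_eq_mul, ← smul_eq_mul, ← f.map_smul b, ← f.map_smul a]
      refine hker _ _ ?_
      rw [map_smul, map_smul, hs, hp, smul_comm])
  refine ⟨t, fun q => hab.mul_left_cancel ?_⟩
  rw [← ht, LinearMap.comp_apply, ← smul_eq_mul, ← map_smul]
  exact hker _ _ (by rw [hs, map_smul])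

end

section

variable {P₀ P₁ P₂ P₃ : Type*} [AddCommGroup P₀] [AddCommGroup P₁] [AddCommGroup P₂]
  [AddCommGroup P₃] [Module R P₀] [Module R P₁] [Module R P₂] [Module R P₃]

/-- The comparison of a projective resolution of a quotient of `R` by an ideal contained in
`(a, b)` with the Koszul complex on the regular sequence `a, b`. -/
theorem exists_koszul_lift (hab : IsRegularPair a b) [Module.Projective R P₁]
    (d₁ : P₁ →ₗ[R] P₀) (d₂ : P₂ →ₗ[R] P₁) (d₃ : P₃ →ₗ[R] P₂)
    (h₁₂ : ∀ p, d₁ (d₂ p) = 0) (h₂₃ : ∀ p, d₂ (d₃ p) = 0)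
    (e : P₀ →ₗ[R] R) (he : ∀ p, e (d₁ p) ∈ Ideal.span {a, b}) :
    ∃ (v w : P₁ →ₗ[R] R) (c : P₂ →ₗ[R] R), (∀ p, e (d₁ p) = a * v p + b * w p) ∧
      (∀ p, w (d₂ p) = a * c p) ∧ (∀ p, v (d₂ p) = -(b * c p)) ∧ ∀ p, c (d₃ p) = 0 := by
  obtain ⟨v, w, hvw⟩ := LinearMap.exists_eq_mul_add_mul_of_mem_span_pair (e.comp d₁) he
  have h0 : ∀ p, a * v (d₂ p) + b * w (d₂ p) = 0 := fun p => by
    rw [← hvw, LinearMap.comp_apply, h₁₂, map_zero]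
  -- The Koszul relation `a v + b w = 0` on the image of `d₂` makes `w ∘ d₂` divisible by `a`; the
  -- quotient `c` is the degree-two component.
  obtain ⟨c, hc⟩ := LinearMap.exists_eq_smul_of_forall_dvd hab.eq_zero_of_mul_eq_zero (w.comp d₂)
    (fun p => hab.dvd_of_dvd_mul _ ⟨-v (d₂ p), by
      rw [LinearMap.comp_apply]; linear_combination h0 p⟩)
  have hc : ∀ p, w (d₂ p) = a * c p := hc
  refine ⟨v, w, c, hvw, hc, fun p => hab.mul_left_cancel ?_, fun p => hab.mul_left_cancel ?_⟩
  · linear_combination h0 p - b * hc p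
  · rw [← hc, h₂₃, map_zero, mul_zero]

variable {Q₀ Q₁ Q₂ : Type*} [AddCommGroup Q₀] [AddCommGroup Q₁] [AddCommGroup Q₂]
  [Module R Q₀] [Module R Q₁] [Module R Q₂]

/-- `β` says that `z` times the comparison map to the Koszul complex is null-homotopic in degree
two. Correcting `z w f₁` and `z v f₁` by multiples of `β` gives maps killing the image of `d₂'`,
which extend to `Q₀` by the vanishing of `Ext¹`. -/
theorem mul_mem_span_of_eq_comp {a' b' : R} (hab' : IsRegularPair a' b')
    [Module.Projective R Q₀] (d₁ : P₁ →ₗ[R] P₀) (d₂ : P₂ →ₗ[R] P₁)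
    {e : P₀ →ₗ[R] R} {v w : P₁ →ₗ[R] R} {c : P₂ →ₗ[R] R}
    (hvw : ∀ p, e (d₁ p) = a * v p + b * w p) (hw : ∀ p, w (d₂ p) = a * c p)
    (hv : ∀ p, v (d₂ p) = -(b * c p))
    (d₁' : Q₁ →ₗ[R] Q₀) (d₂' : Q₂ →ₗ[R] Q₁) (hd : Function.Exact d₂' d₁')
    (ha : ∀ q, a' • q ∈ LinearMap.range d₁') (hb : ∀ q, b' • q ∈ LinearMap.range d₁')
    (f₀ : Q₀ →ₗ[R] P₀) (f₁ : Q₁ →ₗ[R] P₁) (f₂ : Q₂ →ₗ[R] P₂)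
    (hf₁ : ∀ q, f₀ (d₁' q) = d₁ (f₁ q)) (hf₂ : ∀ q, f₁ (d₂' q) = d₂ (f₂ q))
    {z : R} (β : Q₁ →ₗ[R] R) (hβ : ∀ q, z * c (f₂ q) = β (d₂' q)) (q : Q₀) :
    z * e (f₀ q) ∈ Ideal.span {a, b} := by
  obtain ⟨w', hw'⟩ := hab'.exists_eq_comp_of_comp_eq_zero d₁' d₂' hd ha hb
    (z • w.comp f₁ - a • β) (fun q => by
      simp only [LinearMap.sub_apply, LinearMap.smul_apply, LinearMap.comp_apply, smul_eq_mul, hf₂,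
        hw, ← hβ]
      ring)
  obtain ⟨v', hv'⟩ := hab'.exists_eq_comp_of_comp_eq_zero d₁' d₂' hd ha hb
    (z • v.comp f₁ + b • β) (fun q => by
      simp only [LinearMap.add_apply, LinearMap.smul_apply, LinearMap.comp_apply, smul_eq_mul, hf₂,
        hv, ← hβ]
      ring)
  simp only [LinearMap.sub_apply, LinearMap.add_apply, LinearMap.smul_apply, LinearMap.comp_apply,
    smul_eq_mul] at hw' hv'
  have h : z * e (f₀ q) - a * v' q - b * w' q = 0 := by
    -- After multiplication by `a'` the element `a' q` is `d₁' p`, and the two contributions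
    -- `±abβ(p)` cancel.
    refine hab'.eq_zero_of_mul_eq_zero _ ?_
    obtain ⟨p, hp⟩ := ha q
    have h1 : a' * e (f₀ q) = a * v (f₁ p) + b * w (f₁ p) := by
      rw [← hvw, ← hf₁, hp, map_smul, map_smul, smul_eq_mul]
    have h2 : a' * v' q = v' (d₁' p) := by rw [hp, map_smul, smul_eq_mul]
    have h3 : a' * w' q = w' (d₁' p) := by rw [hp, map_smul, smul_eq_mul]
    linear_combination z * h1 - a * h2 - b * h3 + a * hv' p + b * hw' p
  exact Ideal.mem_span_pair.2 ⟨v' q, w' q, by linear_combination -h⟩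

end

end IsRegularPair

/-! ### Ext classes represented by explicit cocycles. -/

section CochainClasses

open CategoryTheory Limits Opposite

variable {R : Type u} [CommRing R]

namespace HomologicalComplex

variable {ι : Type*} {s : ComplexShape ι} (K : HomologicalComplex (ModuleCat.{u} R) s)

theorem exists_iCycles_eq {i j : ι} (hj : s.next i = j) (x : K.X i) (hx : K.d i j x = 0) :
    ∃ t : K.cycles i, K.iCycles i t = x := by
  have h := ShortComplex.exact_of_f_is_kernel
    (ShortComplex.mk (K.iCycles i) (K.d i j) (K.iCycles_d i j)) (K.cyclesIsKernel i j hj)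
  exact (ShortComplex.moduleCat_exact_iff _).1 h x hx

theorem iCycles_injective (i : ι) : Function.Injective (K.iCycles i) :=
  (ModuleCat.mono_iff_injective _).1 inferInstance

theorem homologyπ_apply_eq_zero_iff {i j : ι} (hi : s.prev j = i) (t : K.cycles j) :
    K.homologyπ j t = 0 ↔ ∃ y : K.X i, K.d i j y = K.iCycles j t := by
  have hcomp : ∀ y, K.iCycles j (K.toCycles i j y) = K.d i j y := fun y =>
    ConcreteCategory.congr_hom (K.toCycles_i i j) y
  constructor
  · intro h
    have hex := ShortComplex.exact_of_g_is_cokernel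
      (ShortComplex.mk (K.toCycles i j) (K.homologyπ j) (K.toCycles_comp_homologyπ i j))
      (K.homologyIsCokernel i j hi)
    obtain ⟨y, rfl⟩ := (ShortComplex.moduleCat_exact_iff _).1 hex t h
    exact ⟨y, (hcomp y).symm⟩
  · rintro ⟨y, hy⟩
    rw [← hcomp] at hy
    rw [← K.iCycles_injective j hy]
    exact ConcreteCategory.congr_hom (K.toCycles_comp_homologyπ i j) y

end HomologicalComplex

namespace CategoryTheory.ProjectiveResolution

/-- The map on cochain complexes `Hom(P, Y) → Hom(Q, Y)` induced by a chain map `Q → P`. -/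
noncomputable def linearYonedaMap {K L : ChainComplex (ModuleCat.{u} R) ℕ} (φ : L ⟶ K)
    (Y : ModuleCat.{u} R) : K.linearYonedaObj R Y ⟶ L.linearYonedaObj R Y :=
  (HomologicalComplex.unopFunctor _ _).map
    (((((linearYoneda R (ModuleCat.{u} R)).obj Y).rightOp.mapHomologicalComplex _).map φ).op)

theorem homologyUnop_inv_naturality {V : Type*} [Category* V] [Abelian V] {ι : Type*}
    {s : ComplexShape ι} {K L : HomologicalComplex Vᵒᵖ s} (φ : K ⟶ L) (i : ι) :
    (L.homologyUnop i).inv ≫ HomologicalComplex.homologyMap (K := L.unop) (L := K.unop)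
      ((HomologicalComplex.unopFunctor _ _).map φ.op) i =
    (HomologicalComplex.homologyMap φ i).unop ≫ (K.homologyUnop i).inv := by
  have h : HomologicalComplex.homologyMap (K := L.unop) (L := K.unop)
      ((HomologicalComplex.unopFunctor _ _).map φ.op) i ≫ (K.homologyUnop i).hom =
      (L.homologyUnop i).hom ≫ (HomologicalComplex.homologyMap φ i).unop :=
    (congrArg Quiver.Hom.unop (HomologicalComplex.homologyOp_hom_naturality
      ((HomologicalComplex.unopFunctor _ _).map φ.op) i)).symm
  rw [Iso.inv_comp_eq, ← Category.assoc, Iso.eq_comp_inv, h]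

/-- `P.isoExt` is a composite of the comparison for left derived functors into the opposite category
and the passage of homology through `unop`; the two naturality squares are pasted. -/
theorem isoExt_hom_naturality {N N' : ModuleCat.{u} R} (f : N' ⟶ N) (P : ProjectiveResolution N)
    (Q : ProjectiveResolution N') (φ : Q.complex ⟶ P.complex)
    (comm : φ.f 0 ≫ P.π.f 0 = Q.π.f 0 ≫ f) (n : ℕ) (Y : ModuleCat.{u} R) :
    ((Ext R (ModuleCat.{u} R) n).map f.op).app Y ≫ (Q.isoExt n Y).hom =
      (P.isoExt n Y).hom ≫ HomologicalComplex.homologyMap (linearYonedaMap φ Y) n := by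
  let F := ((linearYoneda R (ModuleCat.{u} R)).obj Y).rightOp
  let G := F.mapHomologicalComplex (ComplexShape.down ℕ)
  have h₁ : ((F.leftDerived n).map f).unop ≫ (Q.isoLeftDerivedObj F n).inv.unop =
      (P.isoLeftDerivedObj F n).inv.unop ≫ (HomologicalComplex.homologyMap (G.map φ) n).unop :=
    congrArg Quiver.Hom.unop (ProjectiveResolution.isoLeftDerivedObj_inv_naturality f Q P φ comm F n)
  have h₂ := homologyUnop_inv_naturality (G.map φ) n
  have paste : ∀ {A₁ A₂ A₃ B₁ B₂ B₃ : ModuleCat.{u} R} (a : A₁ ⟶ A₂) (b : A₂ ⟶ A₃) (c : B₁ ⟶ B₂)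
      (d : B₂ ⟶ B₃) (v₁ : A₁ ⟶ B₁) (v₂ : A₂ ⟶ B₂) (v₃ : A₃ ⟶ B₃),
      v₁ ≫ c = a ≫ v₂ → b ≫ v₃ = v₂ ≫ d → v₁ ≫ c ≫ d = (a ≫ b) ≫ v₃ := by
    intro _ _ _ _ _ _ a b c d v₁ v₂ v₃ h h'
    rw [Category.assoc, h', ← Category.assoc, h, Category.assoc]
  exact paste (P.isoLeftDerivedObj F n).inv.unop ((G.obj P.complex).homologyUnop n).inv
    (Q.isoLeftDerivedObj F n).inv.unop ((G.obj Q.complex).homologyUnop n).inv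
    ((F.leftDerived n).map f).unop (HomologicalComplex.homologyMap (G.map φ) n).unop
    (HomologicalComplex.homologyMap (K := (G.obj P.complex).unop) (L := (G.obj Q.complex).unop)
      ((HomologicalComplex.unopFunctor _ _).map (G.map φ).op) n) h₁ h₂

variable {N : ModuleCat.{u} R} (P : ProjectiveResolution N) {n : ℕ} {Y : ModuleCat.{u} R}

/-- The cochain `c : Pₙ → Y` is a cocycle whose class is `α ∈ Extⁿ(N, Y)`. -/
def Represents (c : P.complex.X n ⟶ Y)
    (α : ((Ext R (ModuleCat.{u} R) n).obj (op N)).obj Y) : Prop :=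
  ∃ t : (P.complex.linearYonedaObj R Y).cycles n,
    (P.complex.linearYonedaObj R Y).iCycles n t = c ∧
      (P.isoExt n Y).inv ((P.complex.linearYonedaObj R Y).homologyπ n t) = α

variable {P}

theorem exists_represents (c : P.complex.X n ⟶ Y) (hc : P.complex.d (n + 1) n ≫ c = 0) :
    ∃ α, P.Represents c α := by
  obtain ⟨t, ht⟩ := (P.complex.linearYonedaObj R Y).exists_iCycles_eq
    (i := n) (j := n + 1) (by simp) c hc
  exact ⟨_, t, ht, rfl⟩

namespace Represents

theorem smul {c : P.complex.X n ⟶ Y} {α} (h : P.Represents c α) (r : R) :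
    P.Represents (r • c) (r • α) := by
  obtain ⟨t, rfl, rfl⟩ := h
  exact ⟨r • t, by rw [map_smul]; rfl, by rw [map_smul, map_smul]⟩

theorem eq_zero_iff {c : P.complex.X (n + 1) ⟶ Y} {α} (h : P.Represents c α) :
    α = 0 ↔ ∃ y : P.complex.X n ⟶ Y, P.complex.d (n + 1) n ≫ y = c := by
  obtain ⟨t, rfl, rfl⟩ := h
  have h := (P.complex.linearYonedaObj R Y).homologyπ_apply_eq_zero_iff
    (i := n) (j := n + 1) (by simp) t
  refine Iff.trans ⟨fun h0 => ?_, fun h0 => ?_⟩ h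
  · have := congrArg (P.isoExt (n + 1) Y).hom h0
    rwa [map_zero, ← ConcreteCategory.comp_apply, Iso.inv_hom_id, ConcreteCategory.id_apply] at this
  · rw [h0, map_zero]

theorem map {N' : ModuleCat.{u} R} {Q : ProjectiveResolution N'} {c : P.complex.X n ⟶ Y} {α}
    (h : P.Represents c α) (f : N' ⟶ N) (φ : Q.complex ⟶ P.complex)
    (comm : φ.f 0 ≫ P.π.f 0 = Q.π.f 0 ≫ f) :
    Q.Represents (φ.f n ≫ c) (((Ext R (ModuleCat.{u} R) n).map f.op).app Y α) := by
  obtain ⟨t, rfl, rfl⟩ := h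
  refine ⟨HomologicalComplex.cyclesMap (linearYonedaMap φ Y) n t, ?_, ?_⟩
  · exact ConcreteCategory.congr_hom
      (HomologicalComplex.cyclesMap_i (linearYonedaMap φ Y) n) t
  · have h1 := ConcreteCategory.congr_hom
      (HomologicalComplex.homologyπ_naturality (linearYonedaMap φ Y) n) t
    have h2 := isoExt_hom_naturality f P Q φ comm n Y
    rw [← Iso.inv_comp_eq, ← Category.assoc, ← Iso.eq_comp_inv] at h2
    have h2 := ConcreteCategory.congr_hom h2
      ((P.complex.linearYonedaObj R Y).homologyπ n t)
    rw [ConcreteCategory.comp_apply, ConcreteCategory.comp_apply] at h1 h2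
    rw [← h1, h2]

end Represents

end CategoryTheory.ProjectiveResolution

end CochainClasses

/-! ### Projective resolutions as exact sequences of linear maps. -/

namespace CategoryTheory.ProjectiveResolution

open Limits

variable {R : Type u} [CommRing R] {N : ModuleCat.{u} R} (P : ProjectiveResolution N)

/-- The augmentation of a projective resolution, as a linear map. -/
noncomputable def augmentation : P.complex.X 0 →ₗ[R] N := (P.π.f 0).hom

theorem augmentation_surjective : Function.Surjective P.augmentation :=
  (ModuleCat.epi_iff_surjective (P.π.f 0)).1 inferInstance

theorem exact_augmentation : Function.Exact (P.complex.d 1 0).hom P.augmentation := by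
  intro p
  constructor
  · intro h
    exact (ShortComplex.moduleCat_exact_iff _).1 P.exact₀ p h
  · rintro ⟨q, rfl⟩
    exact ConcreteCategory.congr_hom P.complex_d_comp_π_f_zero q

theorem exact_d (n : ℕ) :
    Function.Exact (P.complex.d (n + 2) (n + 1)).hom (P.complex.d (n + 1) n).hom := by
  intro p
  constructor
  · intro h
    exact (ShortComplex.moduleCat_exact_iff _).1 (P.exact_succ n) p h
  · rintro ⟨q, rfl⟩
    exact ConcreteCategory.congr_hom (P.complex.d_comp_d (n + 2) (n + 1) n) q

theorem module_projective_X (n : ℕ) : Module.Projective R (P.complex.X n) :=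
  (IsProjective.iff_projective _).2 (P.projective n)

end CategoryTheory.ProjectiveResolution

/-! ### A class in local cohomology killed by `a, b` but not by `z`. -/

section LocalCohomology

open CategoryTheory Limits Opposite

variable {R : Type u} [CommRing R]

/-- The colimit is filtered and evaluation at `Y` preserves it, so an element that dies in the
colimit dies at a finite stage. -/
theorem localCohomology.exists_map_eq_zero_of_ι_eq_zero (I : Ideal R) (n t : ℕ)
    (Y : ModuleCat.{u} R)
    (α : ((Ext R (ModuleCat.{u} R) n).obj (op (ModuleCat.of R (R ⧸ I ^ t)))).obj Y)
    (h : (colimit.ι (localCohomology.diagram (localCohomology.idealPowersDiagram I) n)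
      (op (op t))).app Y α = 0) :
    ∃ (s : ℕ) (hs : I ^ s ≤ I ^ t), ((Ext R (ModuleCat.{u} R) n).map
      (ModuleCat.ofHom (Submodule.mapQ (I ^ s) (I ^ t) LinearMap.id hs)).op).app Y α = 0 := by
  let D := localCohomology.diagram (localCohomology.idealPowersDiagram I) n
  have : IsFiltered ℕᵒᵖᵒᵖ := IsFiltered.of_equivalence (opOpEquivalence ℕ).symm
  have := preservesFilteredColimitsOfSize_shrink.{0, u, 0, u} (forget (ModuleCat.{u} R))
  have : PreservesColimitsOfShape ℕᵒᵖᵒᵖ (forget (ModuleCat.{u} R)) :=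
    PreservesFilteredColimitsOfSize.preserves_filtered_colimits _
  let hD := isColimitOfPreserves ((evaluation (ModuleCat.{u} R) (ModuleCat.{u} R)).obj Y)
    (colimit.isColimit D)
  obtain ⟨k, f, f', hk⟩ := (Concrete.isColimit_rep_eq_iff_exists
    (D ⋙ (evaluation (ModuleCat.{u} R) (ModuleCat.{u} R)).obj Y) hD (i := op (op t))
    (j := op (op t)) α 0).1 (h.trans (map_zero _).symm)
  refine ⟨k.unop.unop, ((localCohomology.idealPowersDiagram I).map f.unop).down.down, ?_⟩
  rw [map_zero] at hk
  exact hk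

theorem IsRegularPair.exists_localCohomology {a b : R} (hab : IsRegularPair a b) (I : Ideal R)
    (ha : a ∈ I) (hb : b ∈ I) {t : ℕ} (ht : I ^ t ≤ Ideal.span {a, b}) {z : R}
    (hz : z ∉ Ideal.span {a, b}) :
    ∃ η : (localCohomology I 2).obj (ModuleCat.of R R), a • η = 0 ∧ b • η = 0 ∧ z • η ≠ 0 := by
  let P := projectiveResolution (ModuleCat.of R (R ⧸ I ^ t))
  have := P.module_projective_X 0
  have := P.module_projective_X 1
  obtain ⟨e, he⟩ := Module.projective_lifting_property (I ^ t).mkQ P.augmentation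
    (I ^ t).mkQ_surjective
  have he : ∀ p, Submodule.Quotient.mk (e p) = P.augmentation p := fun p => LinearMap.congr_fun he p
  obtain ⟨v, w, c, hvw, hw, hv, hc⟩ := hab.exists_koszul_lift (P.complex.d 1 0).hom
    (P.complex.d 2 1).hom (P.complex.d 3 2).hom (fun p => (P.exact_d 0).apply_apply_eq_zero p)
    (fun p => (P.exact_d 1).apply_apply_eq_zero p) e (fun p => ht (by
      rw [← Submodule.Quotient.mk_eq_zero, he]
      exact P.exact_augmentation.apply_apply_eq_zero p))
  obtain ⟨α, hα⟩ := P.exists_represents (ModuleCat.ofHom c) (by ext p; exact hc p)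
  -- The lifts `w` and `-v` exhibit `a c` and `b c` as coboundaries.
  have haα : a • α = 0 := (hα.smul a).eq_zero_iff.2
    ⟨ModuleCat.ofHom w, by ext p; exact hw p⟩
  have hbα : b • α = 0 := (hα.smul b).eq_zero_iff.2
    ⟨ModuleCat.ofHom (-v), by ext p; exact (congrArg Neg.neg (hv p)).trans (neg_neg _)⟩
  let ι := (colimit.ι (localCohomology.diagram (localCohomology.idealPowersDiagram I) 2)
      (op (op t))).app (ModuleCat.of R R)
  refine ⟨ι α, (map_smul ι.hom a α).symm.trans ((congrArg ι.hom haα).trans (map_zero ι.hom)),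
    (map_smul ι.hom b α).symm.trans ((congrArg ι.hom hbα).trans (map_zero ι.hom)), fun h => ?_⟩
  obtain ⟨s, hs, h⟩ := localCohomology.exists_map_eq_zero_of_ι_eq_zero I 2 t (ModuleCat.of R R)
    (z • α) ((map_smul ι.hom z α).trans h)
  let f := ModuleCat.ofHom (Submodule.mapQ (I ^ s) (I ^ t) LinearMap.id hs)
  let Q := projectiveResolution (ModuleCat.of R (R ⧸ I ^ s))
  have := Q.module_projective_X 0
  let φ := ProjectiveResolution.lift f Q P
  have hφ := ProjectiveResolution.lift_commutes_zero f Q P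
  obtain ⟨β, hβ⟩ := ((hα.smul z).map f φ hφ).eq_zero_iff.1 h
  have hrange : ∀ r ∈ I, ∀ q, r ^ s • q ∈ LinearMap.range (Q.complex.d 1 0).hom := by
    intro r hr q
    refine (Q.exact_augmentation _).1 ?_
    rw [map_smul]
    obtain ⟨y, hy⟩ := Submodule.Quotient.mk_surjective _ (Q.augmentation q)
    rw [← hy, ← Submodule.Quotient.mk_smul, Submodule.Quotient.mk_eq_zero]
    exact Ideal.mul_mem_right _ _ (Ideal.pow_mem_pow hr s)
  have hmem := fun q => (hab.pow s s).mul_mem_span_of_eq_comp (P.complex.d 1 0).hom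
    (P.complex.d 2 1).hom hvw hw hv (Q.complex.d 1 0).hom (Q.complex.d 2 1).hom (Q.exact_d 0)
    (hrange a ha) (hrange b hb) (φ.f 0).hom (φ.f 1).hom (φ.f 2).hom
    (fun q => (ConcreteCategory.congr_hom (φ.comm 1 0) q).symm)
    (fun q => (ConcreteCategory.congr_hom (φ.comm 2 1) q).symm) β.hom
    (fun q => (ConcreteCategory.congr_hom hβ q).symm) q
  obtain ⟨q, hq⟩ := Q.augmentation_surjective (Submodule.Quotient.mk 1)
  -- `φ` lifts the projection `R/I^s → R/I^t`, so a lift `q` of `1` is carried to `1` modulo `I^t ⊆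
  -- (a,b)`. Hence `z e(φ q) ∈ (a,b)` gives `z ∈ (a,b)`.
  have h1 : 1 - e ((φ.f 0).hom q) ∈ Ideal.span {a, b} := by
    refine ht ?_
    rw [← Submodule.Quotient.eq, he]
    refine Eq.trans ?_ (ConcreteCategory.congr_hom hφ q).symm
    change _ = f.hom (Q.augmentation q)
    rw [hq]
    rfl
  refine hz ?_
  have h2 := add_mem (Ideal.mul_mem_left _ z h1) (hmem q)
  rwa [mul_sub, mul_one, sub_add_cancel] at h2

end LocalCohomology

/-! ### Module closures and the injective hull as a cogenerator. -/

section Rationality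

variable {R : Type u} [CommRing R]

/-- The annihilator of `η` lies in the maximal ideal, so `Rη` maps onto the residue field with `η ↦
1`; composing with the hull embedding and extending by injectivity gives `f`. -/
theorem exists_residueHull_apply_ne_zero [IsLocalRing R] {H : Type u} [AddCommGroup H] [Module R H]
    {η : H} (hη : η ≠ 0) : ∃ f : H →ₗ[R] residueHull R, f η ≠ 0 := by
  obtain ⟨ι, hι⟩ := (exists_isInjectiveHull R (IsLocalRing.ResidueField R)).choose_spec
  let s := LinearMap.toSpanSingleton R H η
  have hs : LinearMap.ker s ≤ LinearMap.ker (Algebra.linearMap R (IsLocalRing.ResidueField R)) := by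
    intro r hr
    rw [LinearMap.mem_ker, LinearMap.toSpanSingleton_apply] at hr
    refine (IsLocalRing.residue_eq_zero_iff r).2 fun hu => hη ?_
    rwa [hu.smul_eq_zero] at hr
  obtain ⟨f, hf⟩ := hι.module_injective.out ((LinearMap.ker s).liftQ s le_rfl)
    (LinearMap.ker_eq_bot.1 (Submodule.ker_liftQ_eq_bot _ _ _ le_rfl))
    (ι.comp ((LinearMap.ker s).liftQ (Algebra.linearMap R (IsLocalRing.ResidueField R)) hs))
  refine ⟨f, fun h0 => one_ne_zero (α := IsLocalRing.ResidueField R) (hι.injective ?_)⟩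
  have h1 := hf (Submodule.Quotient.mk 1)
  have h2 : s 1 = η := one_smul R η
  rw [Submodule.liftQ_apply, h2, LinearMap.comp_apply, Submodule.liftQ_apply,
    Algebra.linearMap_apply, map_one] at h1
  rw [map_zero, ← h1]
  exact h0

theorem mem_moduleClosureSubmodule_span_pair {B : Type v} [AddCommGroup B] [Module R B] {a b z : R}
    (h : ∀ m : B, ∃ m₁ m₂ : B, z • m = a • m₁ + b • m₂) :
    z ∈ moduleClosureSubmodule B (Ideal.span {a, b}) := by
  intro m
  obtain ⟨m₁, m₂, hm⟩ := h m
  have ha : a ∈ Ideal.span {a, b} := Ideal.subset_span (Set.mem_insert _ _)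
  have hb : b ∈ Ideal.span {a, b} := Ideal.subset_span (Set.mem_insert_of_mem _ rfl)
  refine ⟨m₁ ⊗ₜ[R] ⟨a, ha⟩ + m₂ ⊗ₜ[R] ⟨b, hb⟩, ?_⟩
  rw [map_add, LinearMap.lTensor_tmul, LinearMap.lTensor_tmul]
  change m₁ ⊗ₜ[R] a + m₂ ⊗ₜ[R] b = m ⊗ₜ[R] z
  have key : ∀ (r : R) (n : B), n ⊗ₜ[R] r = (r • n) ⊗ₜ[R] (1 : R) := fun r n => by
    rw [TensorProduct.smul_tmul, smul_eq_mul, mul_one]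
  rw [key a, key b, key z, hm, TensorProduct.add_tmul]

theorem smul_mem_moduleClosureSubmodule_bot {B : Type v} [AddCommGroup B] [Module R B] {a b z : R}
    (h : ∀ m : B, ∃ m₁ m₂ : B, z • m = a • m₁ + b • m₂)
    {W : Type u} [AddCommGroup W] [Module R W] {η : W} (ha : a • η = 0) (hb : b • η = 0) :
    z • η ∈ moduleClosureSubmodule B (⊥ : Submodule R W) := by
  intro m
  obtain ⟨m₁, m₂, hm⟩ := h m
  rw [← TensorProduct.smul_tmul, hm, TensorProduct.add_tmul, TensorProduct.smul_tmul,
    TensorProduct.smul_tmul, ha, hb, TensorProduct.tmul_zero, TensorProduct.tmul_zero, add_zero]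
  exact zero_mem _

theorem not_isClRational_of_mem_bot_closure [IsLocalRing R] (c : ClosureOperation R)
    {η : topLocalCohomology R} (hη : η ≠ 0)
    (hc : η ∈ c.cl (⊥ : Submodule R (topLocalCohomology R))) :
    ¬ IsClRational c := by
  intro h
  obtain ⟨f, hf⟩ := exists_residueHull_apply_ne_zero (R := R) hη
  have hmem : f ∈ testSubmodule c := by
    rw [show testSubmodule c = ⊤ from h]
    trivial
  exact hf (hmem η hc)

end Rationality

/-! ### Matrix cokernels and the conclusion. -/

theorem exists_smul_eq_add_of_equiv_coker {R : Type u} [CommRing R] {a b z : R} {n : ℕ}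
    (φ : Matrix (Fin n) (Fin n) R) (hφ : ∀ i j, φ i j ∈ Ideal.span {a, b})
    {M : Type v} [AddCommGroup M] [Module R M]
    (e : M ≃ₗ[R] (Fin n → R) ⧸ LinearMap.range
      (Matrix.mulVecLin (z • (1 : Matrix (Fin n) (Fin n) R) - φ))) (m : M) :
    ∃ m₁ m₂ : M, z • m = a • m₁ + b • m₂ := by
  obtain ⟨w, hw⟩ := Submodule.Quotient.mk_surjective _ (e m)
  have hmem : ∀ i, (φ.mulVec w) i ∈ Ideal.span {a, b} := fun i => by
    rw [Matrix.mulVec, dotProduct]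
    exact sum_mem fun j _ => Ideal.mul_mem_right (w j) _ (hφ i j)
  choose p q hpq using fun i => Ideal.mem_span_pair.1 (hmem i)
  refine ⟨e.symm (Submodule.Quotient.mk p), e.symm (Submodule.Quotient.mk q), e.injective ?_⟩
  rw [map_smul, map_add, map_smul, map_smul, e.apply_symm_apply, e.apply_symm_apply, ← hw,
    ← Submodule.Quotient.mk_smul, ← Submodule.Quotient.mk_smul, ← Submodule.Quotient.mk_smul,
    ← Submodule.Quotient.mk_add, Submodule.Quotient.eq]
  -- In the cokernel `z w = φ w`, and the entries of `φ w` are `a p + b q`; the difference is the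
  -- image of `w` itself.
  refine ⟨w, ?_⟩
  have : a • p + b • q = φ.mulVec w := by
    ext i
    rw [← hpq i, Pi.add_apply, Pi.smul_apply, Pi.smul_apply, smul_eq_mul, smul_eq_mul]
    ring
  rw [this, Matrix.mulVecLin_apply, Matrix.sub_mulVec, Matrix.smul_mulVec, Matrix.one_mulVec]

theorem DoublePointRing.exists_topLocalCohomology {k : Type u} [Field k]
    {g : MvPowerSeries (Fin 2) k}
    (hg : g ∈ Ideal.span {(MvPowerSeries.X 0 : MvPowerSeries (Fin 2) k), MvPowerSeries.X 1}) :
    haveI : IsLocalRing (DoublePointRing g) := isLocalRing hg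
    ∃ η : topLocalCohomology (DoublePointRing g), x g • η = 0 ∧ y g • η = 0 ∧ z g • η ≠ 0 := by
  have : IsLocalRing (DoublePointRing g) := isLocalRing hg
  have hdim : ((ringKrullDim (DoublePointRing g)).unbotD 0).toNat = 2 := by
    rw [ringKrullDim_eq_two hg]
    rfl
  rw [topLocalCohomology, hdim]
  exact (isRegularPair hg).exists_localCohomology _ (x_mem_maximalIdeal hg)
    (y_mem_maximalIdeal hg) (maximalIdeal_sq_le hg) (z_not_mem hg)

theorem mainTheorem11 {k : Type u} [Field k] (g : MvPowerSeries (Fin 2) k)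
    (hg : g ∈ Ideal.span {(MvPowerSeries.X 0 : MvPowerSeries (Fin 2) k), MvPowerSeries.X 1})
    (n : ℕ) (φ : Matrix (Fin n) (Fin n) (MvPowerSeries (Fin 2) k))
    (hφ : ∀ i j,
      φ i j ∈ Ideal.span {(MvPowerSeries.X 0 : MvPowerSeries (Fin 2) k), MvPowerSeries.X 1})
    (M : Type v) [AddCommGroup M] [Module (DoublePointRing g) M]
    (e : M ≃ₗ[DoublePointRing g] (Fin n → DoublePointRing g) ⧸
      LinearMap.range (Matrix.mulVecLin
        (DoublePointRing.z g • (1 : Matrix (Fin n) (Fin n) (DoublePointRing g)) -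
          φ.map (DoublePointRing.ofXY g)))) :
    haveI : IsLocalRing (DoublePointRing g) := DoublePointRing.isLocalRing hg
    DoublePointRing.z g ∈ (moduleClosure (R := DoublePointRing g) M).cl
        (Ideal.span {DoublePointRing.x g, DoublePointRing.y g}) ∧
      DoublePointRing.z g ∉ Ideal.span {DoublePointRing.x g, DoublePointRing.y g} ∧
      ¬ IsClRational (moduleClosure (R := DoublePointRing g) M) := by
  have : IsLocalRing (DoublePointRing g) := DoublePointRing.isLocalRing hg
  have hM := exists_smul_eq_add_of_equiv_coker (φ.map (DoublePointRing.ofXY g))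
    (fun i j => DoublePointRing.ofXY_mem (hφ i j)) e
  obtain ⟨η, hx, hy, hz⟩ := DoublePointRing.exists_topLocalCohomology hg
  exact ⟨mem_moduleClosureSubmodule_span_pair hM, DoublePointRing.z_not_mem hg,
    not_isClRational_of_mem_bot_closure _ hz (smul_mem_moduleClosureSubmodule_bot hM hx hy)⟩
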